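/- Let $\mathcal H$ be a real or complex Hilbert space. A sequence $\{f_n\}_{n=1}^\infty$ (more generally a countable family) in $\mathcal H$ is \emph{Bessel} if there is $M>0$ with $\sum_n|\langle x,f_n\rangle|^2\le M\|x\|^2$ for all $x\in\mathcal H$. A Bessel family is a \emph{frame} if there is $m>0$ with $m\|x\|^2\le\sum_n|\langle x,f_n\rangle|^2$ for all $x\in\mathcal H$; it is a \emph{Riesz sequence} if there is $m>0$ with $m\sum_n|c_n|^2\le\|\sum_n c_nf_n\|^2$ for all $c\in\ell^2$; it is a \emph{Riesz basis} if it is both a frame and a Riesz sequence. A Bessel sequence is a \emph{pseudo-frame} if it becomes a frame after adding finitely many suitable vectors, a \emph{pseudo-Riesz sequence} if it becomes a Riesz sequence after removing finitely many of its terms, and a \emph{pseudo-Riesz basis} if it becomes a Riesz basis for $\mathcal H$ after removing finitely many of its terms and adding finitely many suitable vectors. For a Bessel sequence $\{f_n\}_{n=1}^\infty$ let $S_f:\ell^2(\mathbb N)\to\mathcal H$, $S_fc=\sum_{n=1}^\infty c_nf_n$, be its synthesis operator, let $\mathcal N_{S_f}$ be its null space, and let $$\gamma=\inf_{c\notin\mathcal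 N_{S_f}}\frac{\|S_fc\|}{d(c,\mathcal N_{S_f})}\in[0,\infty]$$ be its reduced minimum modulus ($\gamma=\infty$ if $S_f=0$), where $d(c,\mathcal N_{S_f})=\inf\{\|c-e\|:e\in\mathcal N_{S_f}\}$. \textbf{Theorem.} Let $\{f_n\}_{n=1}^\infty$ be a pseudo-Riesz sequence (respectively a pseudo-frame, a pseudo-Riesz basis) in $\mathcal H$. Then $\gamma>0$, and every sequence $\{g_n\}_{n=1}^\infty$ in $\mathcal H$ such that $$\sum_{n=1}^\infty\|f_n-g_n\|^2<\gamma^2$$ is also a pseudo-Riesz sequence (respectively a pseudo-frame, a pseudo-Riesz basis). -/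

import Mathlib

open scoped ENNReal lp

/-- The Hilbert space `ℓ²(ι)` of square-summable scalar families indexed by `ι`. -/
abbrev EllTwo (𝕜 : Type*) [RCLike 𝕜] (ι : Type*) : Type _ := lp (fun _ : ι => 𝕜) 2

section Families

variable (𝕜 : Type*) [RCLike 𝕜] {H : Type*} [NormedAddCommGroup H] [InnerProductSpace 𝕜 H]
variable {ι : Type*}

/-- Bessel families: `∑ |⟨x, f i⟩|² ≤ M ‖x‖²` for all `x`, with some `M > 0`
(the series being convergent). -/
def IsBessel (f : ι → H) : Prop :=
  ∃ M : ℝ, 0 < M ∧ ∀ x : H,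
    Summable (fun i => ‖inner 𝕜 x (f i)‖ ^ 2) ∧ ∑' i, ‖inner 𝕜 x (f i)‖ ^ 2 ≤ M * ‖x‖ ^ 2

/-- Frames: Bessel families with a lower frame bound `m ‖x‖² ≤ ∑ |⟨x, f i⟩|²`. -/
structure IsFrame (f : ι → H) : Prop where
  bessel : IsBessel 𝕜 f
  lower : ∃ m : ℝ, 0 < m ∧ ∀ x : H, m * ‖x‖ ^ 2 ≤ ∑' i, ‖inner 𝕜 x (f i)‖ ^ 2

/-- Riesz sequences: Bessel families with a lower Riesz bound
`m ∑ |c i|² ≤ ‖∑ c i f i‖²` for all `c ∈ ℓ²`.  The series on the right converges, by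
`IsBessel.summable_smul` below. -/
structure IsRieszSequence (f : ι → H) : Prop where
  bessel : IsBessel 𝕜 f
  lower : ∃ m : ℝ, 0 < m ∧ ∀ c : EllTwo 𝕜 ι,
    m * ∑' i, ‖c i‖ ^ 2 ≤ ‖∑' i, c i • f i‖ ^ 2

/-- Riesz bases: families that are both a frame and a Riesz sequence. -/
structure IsRieszBasis (f : ι → H) : Prop where
  frame : IsFrame 𝕜 f
  rieszSequence : IsRieszSequence 𝕜 f

/-- Pseudo-frames: Bessel sequences that become a frame after adding finitely many vectors. -/
structure IsPseudoFrame (f : ℕ → H) : Prop where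
  bessel : IsBessel 𝕜 f
  exists_frame : ∃ (m : ℕ) (h : Fin m → H), IsFrame 𝕜 (Sum.elim h f)

/-- Pseudo-Riesz sequences: Bessel sequences that become a Riesz sequence after removing
finitely many of their terms. -/
structure IsPseudoRieszSequence (f : ℕ → H) : Prop where
  bessel : IsBessel 𝕜 f
  exists_rieszSequence : ∃ σ : Finset ℕ, IsRieszSequence 𝕜 (fun n : {n : ℕ // n ∉ σ} => f n)

/-- Pseudo-Riesz bases: Bessel sequences that become a Riesz basis after removing finitely many
of their terms and adding finitely many vectors. -/
structure IsPseudoRieszBasis (f : ℕ → H) : Prop where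
  bessel : IsBessel 𝕜 f
  exists_rieszBasis : ∃ (σ : Finset ℕ) (m : ℕ) (h : Fin m → H),
    IsRieszBasis 𝕜 (Sum.elim h (fun n : {n : ℕ // n ∉ σ} => f n))

end Families

section Synthesis

variable {𝕜 : Type*} [RCLike 𝕜] {H : Type*} [NormedAddCommGroup H] [InnerProductSpace 𝕜 H]
variable {ι : Type*}

theorem EllTwo.hasSum_sq (c : EllTwo 𝕜 ι) : HasSum (fun i => ‖c i‖ ^ 2) (‖c‖ ^ 2) := by
  have h := lp.hasSum_norm (p := 2) (by norm_num) c
  simpa using h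

theorem IsBessel.exists_finset_bound {f : ι → H} (hf : IsBessel 𝕜 f) :
    ∃ M : ℝ, 0 < M ∧ ∀ (c : ι → 𝕜) (s : Finset ι),
      ‖∑ i ∈ s, c i • f i‖ ^ 2 ≤ M * ∑ i ∈ s, ‖c i‖ ^ 2 := by
  obtain ⟨M, hM, h⟩ := hf
  refine ⟨M, hM, fun c s => ?_⟩
  set v := ∑ i ∈ s, c i • f i with hv
  have h1 : ‖v‖ ^ 2 ≤ ∑ i ∈ s, ‖c i‖ * ‖inner 𝕜 v (f i)‖ := by
    calc ‖v‖ ^ 2 = ‖inner 𝕜 v v‖ := by rw [inner_self_eq_norm_sq_to_K]; simp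
      _ = ‖∑ i ∈ s, c i * inner 𝕜 v (f i)‖ := by
        conv_lhs => rw [hv]
        rw [← hv, hv, inner_sum]
        simp [inner_smul_right]
      _ ≤ _ := by
        refine (norm_sum_le _ _).trans (le_of_eq ?_)
        simp
  have h2 := Finset.sum_mul_sq_le_sq_mul_sq s (fun i => ‖c i‖) (fun i => ‖inner 𝕜 v (f i)‖)
  have h3 : ∑ i ∈ s, ‖inner 𝕜 v (f i)‖ ^ 2 ≤ M * ‖v‖ ^ 2 :=
    ((h v).1.sum_le_tsum s (fun i _ => by positivity)).trans (h v).2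
  have hC : 0 ≤ ∑ i ∈ s, ‖c i‖ ^ 2 := Finset.sum_nonneg fun i _ => by positivity
  by_cases hv0 : ‖v‖ ^ 2 = 0
  · rw [hv0]; positivity
  have hpos : 0 < ‖v‖ ^ 2 := lt_of_le_of_ne (by positivity) (Ne.symm hv0)
  have h4 : (‖v‖ ^ 2) ^ 2 ≤ (∑ i ∈ s, ‖c i‖ ^ 2) * (M * ‖v‖ ^ 2) :=
    ((pow_le_pow_left₀ hpos.le h1 2).trans h2).trans (mul_le_mul_of_nonneg_left h3 hC)
  nlinarith

variable [CompleteSpace H]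

/-- For a Bessel family and `c ∈ ℓ²`, the series `∑ c i f i` converges (unconditionally). -/
theorem IsBessel.summable_smul {f : ι → H} (hf : IsBessel 𝕜 f) (c : EllTwo 𝕜 ι) :
    Summable (fun i => c i • f i) := by
  obtain ⟨M, hM, h⟩ := hf.exists_finset_bound
  rw [summable_iff_vanishing_norm]
  intro ε hε
  obtain ⟨s, hs⟩ := summable_iff_vanishing_norm.1 (EllTwo.hasSum_sq c).summable (ε ^ 2 / M)
    (by positivity)
  refine ⟨s, fun t ht => ?_⟩
  have h1 := (le_abs_self _).trans_lt (hs t ht)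
  rw [lt_div_iff₀ hM] at h1
  have h2 := h c t
  exact lt_of_pow_lt_pow_left₀ 2 hε.le (by linarith)

/-- The synthesis operator `S : ℓ²(ι) → H`, `S c = ∑ c i f i`, of a Bessel family `f`,
as a bounded linear operator. -/
noncomputable def IsBessel.synthesis {f : ι → H} (hf : IsBessel 𝕜 f) : EllTwo 𝕜 ι →L[𝕜] H :=
  LinearMap.mkContinuousOfExistsBound
    { toFun := fun c => ∑' i, c i • f i
      map_add' := fun c d => by
        rw [← (hf.summable_smul c).tsum_add (hf.summable_smul d)]
        simp [add_smul]
      map_smul' := fun a c => by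
        simp only [RingHom.id_apply]
        rw [← (hf.summable_smul c).tsum_const_smul a]
        simp [mul_smul] }
    (by
      obtain ⟨M, hM, h⟩ := hf.exists_finset_bound
      refine ⟨√M, fun c => ?_⟩
      refine le_of_tendsto (hf.summable_smul c).hasSum.norm (Filter.Eventually.of_forall ?_)
      intro s
      refine le_of_sq_le_sq ?_ (by positivity)
      rw [mul_pow, Real.sq_sqrt hM.le]
      refine (h c s).trans (mul_le_mul_of_nonneg_left ?_ hM.le)
      exact sum_le_hasSum s (fun i _ => by positivity) (EllTwo.hasSum_sq c))

theorem IsBessel.synthesis_apply {f : ι → H} (hf : IsBessel 𝕜 f) (c : EllTwo 𝕜 ι) :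
    hf.synthesis c = ∑' i, c i • f i := rfl

end Synthesis

/-- The reduced minimum modulus `γ(T) = inf {‖T c‖ / d(c, ker T) : c ∉ ker T}` of a bounded
operator, as an infimum in `[0, ∞]`; hence `γ(0) = ∞`, the infimum over the empty set.  The real
quotients are genuine: `d(c, ker T) > 0` for `c ∉ ker T`, because `ker T` is closed. -/
noncomputable def reducedMinimumModulus {𝕜 E F : Type*} [RCLike 𝕜]
    [NormedAddCommGroup E] [NormedSpace 𝕜 E] [NormedAddCommGroup F] [NormedSpace 𝕜 F]
    (T : E →L[𝕜] F) : ℝ≥0∞ :=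
  ⨅ (c : E) (_ : c ∉ T.ker),
    ENNReal.ofReal (‖T c‖ / Metric.infDist c (T.ker : Set E))

/-! Each pseudo-property survives every perturbation with `∑ ‖f n - g n‖² < ∞`, and a sum in `[0,
∞]` strictly below `γ²` is finite. The mechanism is a cut: a far tail of `f - g` has arbitrarily
small `ℓ²` norm, while the finitely many remaining terms may be treated as added or removed vectors
(`exists_tail_replacement`). Lower frame and Riesz bounds tolerate an `ℓ²`-small error (the two
`exists_perturbation_bound` lemmas), so they pass to the tail of `g`.

Positivity of `γ` comes from closed range. The synthesis operator of a pseudo-Riesz sequence, or the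
adjoint of that of a pseudo-frame, is bounded below on a subspace of finite codimension, hence has
closed range. -/

section ClosedRange

/-! ### Closed range and positivity of the reduced minimum modulus. -/

variable {𝕜 : Type*} [RCLike 𝕜]

/-- `A` maps `ker L` onto a closed subspace, and `ker L` has finite codimension, so the range is
that closed subspace plus a finite-dimensional one. -/
theorem ContinuousLinearMap.isClosed_range_of_boundedBelow_on_ker {E F G : Type*}
    [NormedAddCommGroup E] [NormedSpace 𝕜 E] [CompleteSpace E]
    [NormedAddCommGroup F] [NormedSpace 𝕜 F]
    [NormedAddCommGroup G] [NormedSpace 𝕜 G] [FiniteDimensional 𝕜 G]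
    (A : E →L[𝕜] F) (L : E →L[𝕜] G) {m : ℝ} (hm : 0 < m)
    (h : ∀ x, L x = 0 → m * ‖x‖ ^ 2 ≤ ‖A x‖ ^ 2) :
    IsClosed (A.range : Set F) := by
  have hcl : IsClosed (L.ker : Set E) := L.isClosed_ker
  have : CompleteSpace L.ker := hcl.completeSpace_coe
  have hfg : (L.ker).CoFG := by
    have : FiniteDimensional 𝕜 (E ⧸ (L : E →ₗ[𝕜] G).ker) :=
      (L : E →ₗ[𝕜] G).quotKerEquivRange.symm.finiteDimensional
    exact this
  have hanti : AntilipschitzWith (Real.toNNReal (√m)⁻¹) (A ∘L L.ker.subtypeL) := by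
    refine ContinuousLinearMap.antilipschitz_of_bound _ fun x => ?_
    rw [Real.coe_toNNReal _ (by positivity), inv_mul_eq_div, le_div_iff₀ (by positivity)]
    refine le_of_sq_le_sq ?_ (norm_nonneg _)
    have := h x x.2
    rw [mul_pow, Real.sq_sqrt hm.le]
    simpa [mul_comm] using this
  have hr := hanti.isClosed_range (A ∘L L.ker.subtypeL).uniformContinuous
  refine LinearMap.isClosed_range_of_isClosed_map_of_finiteDimensional_quotient
    (f := (A : E →ₗ[𝕜] F)) (s := L.ker) ?_
  convert hr using 1
  ext y
  simp

/-- Open mapping theorem for `T` onto its range, a Banach space. -/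
theorem ContinuousLinearMap.exists_preimage_of_isClosed_range {E F : Type*}
    [NormedAddCommGroup E] [NormedSpace 𝕜 E] [CompleteSpace E]
    [NormedAddCommGroup F] [NormedSpace 𝕜 F] [CompleteSpace F]
    (T : E →L[𝕜] F) (h : IsClosed (T.range : Set F)) :
    ∃ C : ℝ, 0 < C ∧ ∀ c, ∃ x, T x = T c ∧ ‖x‖ ≤ C * ‖T c‖ := by
  have : CompleteSpace T.range := h.completeSpace_coe
  obtain ⟨C, hC, hx⟩ := (T.codRestrict T.range fun x => ⟨x, rfl⟩).exists_preimage_norm_le (by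
    rintro ⟨_, x, rfl⟩
    exact ⟨x, rfl⟩)
  refine ⟨C, hC, fun c => ?_⟩
  obtain ⟨x, h1, h2⟩ := hx ⟨T c, c, rfl⟩
  exact ⟨x, congrArg Subtype.val h1, h2⟩

/-- The component `p` of `c` orthogonal to `ker T` lies in the closed range of the adjoint, so `p =
T* z` with `‖z‖ ≤ C ‖p‖`. Then `‖p‖² = |⟨z, T p⟩| ≤ C ‖p‖ ‖T p‖`. -/
theorem ContinuousLinearMap.exists_preimage_of_isClosed_range_adjoint {E F : Type*}
    [NormedAddCommGroup E] [InnerProductSpace 𝕜 E] [CompleteSpace E]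
    [NormedAddCommGroup F] [InnerProductSpace 𝕜 F] [CompleteSpace F]
    (T : E →L[𝕜] F) (h : IsClosed (T.adjoint.range : Set E)) :
    ∃ C : ℝ, 0 < C ∧ ∀ c, ∃ x, T x = T c ∧ ‖x‖ ≤ C * ‖T c‖ := by
  obtain ⟨C, hC, hx⟩ := T.adjoint.exists_preimage_of_isClosed_range h
  refine ⟨C, hC, fun c => ?_⟩
  have : CompleteSpace T.ker := T.isClosed_ker.completeSpace_coe
  obtain ⟨k, hk, p, hp, rfl⟩ := T.ker.exists_add_mem_mem_orthogonal c
  have hTk : T k = 0 := hk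
  refine ⟨p, by simp [hTk], ?_⟩
  rw [T.orthogonal_ker, h.submodule_topologicalClosure_eq] at hp
  obtain ⟨y, hy⟩ := hp
  obtain ⟨z, hz1, hz2⟩ := hx y
  have hzp : T.adjoint z = p := hz1.trans hy
  rw [← hz1, hzp] at hz2
  rw [map_add, hTk, zero_add]
  have h1 : ‖p‖ ^ 2 ≤ ‖z‖ * ‖T p‖ := by
    calc ‖p‖ ^ 2 = ‖inner 𝕜 p p‖ := by rw [inner_self_eq_norm_sq_to_K]; simp
      _ = ‖inner 𝕜 z (T p)‖ := by
        conv_lhs => rw [← hzp, ContinuousLinearMap.adjoint_inner_left, hzp]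
      _ ≤ _ := norm_inner_le_norm _ _
  have h2 := mul_le_mul_of_nonneg_right hz2 (norm_nonneg (T p))
  by_cases hp0 : ‖p‖ = 0
  · rw [hp0]; positivity
  · have : 0 < ‖p‖ := lt_of_le_of_ne (norm_nonneg _) (Ne.symm hp0)
    nlinarith

/-- Since `c - x ∈ ker T`, the distance from `c` to the kernel is at most `‖x‖ ≤ C ‖T c‖`; thus `γ ≥
1 / C`. -/
theorem reducedMinimumModulus_pos {E F : Type*}
    [NormedAddCommGroup E] [NormedSpace 𝕜 E] [NormedAddCommGroup F] [NormedSpace 𝕜 F]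
    (T : E →L[𝕜] F) (h : ∃ C : ℝ, 0 < C ∧ ∀ c, ∃ x, T x = T c ∧ ‖x‖ ≤ C * ‖T c‖) :
    0 < reducedMinimumModulus T := by
  obtain ⟨C, hC, hx⟩ := h
  refine lt_of_lt_of_le (ENNReal.ofReal_pos.2 (inv_pos.2 hC)) ?_
  refine le_iInf₂ fun c hc => ENNReal.ofReal_le_ofReal ?_
  have hd : 0 < Metric.infDist c (T.ker : Set E) :=
    (T.isClosed_ker.notMem_iff_infDist_pos ⟨0, T.ker.zero_mem⟩).1 hc
  obtain ⟨x, h1, h2⟩ := hx c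
  have h3 : Metric.infDist c (T.ker : Set E) ≤ ‖x‖ := by
    have hmem : c - x ∈ (T.ker : Set E) := by simp [h1]
    simpa [dist_eq_norm] using Metric.infDist_le_dist_of_mem (x := c) hmem
  rw [le_div_iff₀ hd, inv_mul_le_iff₀ hC]
  exact h3.trans h2

end ClosedRange

theorem norm_add_sq_le_two_mul {E : Type*} [SeminormedAddCommGroup E] (a b : E) :
    ‖a + b‖ ^ 2 ≤ 2 * ‖a‖ ^ 2 + 2 * ‖b‖ ^ 2 := by
  have := pow_le_pow_left₀ (norm_nonneg _) (norm_add_le a b) 2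
  nlinarith [sq_nonneg (‖a‖ - ‖b‖)]

/-! ### Stability of Bessel families and frames; replacement of tails. -/

section Families

variable {𝕜 : Type*} [RCLike 𝕜] {H : Type*} [NormedAddCommGroup H] [InnerProductSpace 𝕜 H]
variable {ι κ : Type*}

theorem IsBessel.comp_injective {f : ι → H} (hf : IsBessel 𝕜 f) {j : κ → ι}
    (hj : Function.Injective j) : IsBessel 𝕜 (f ∘ j) := by
  obtain ⟨M, hM, h⟩ := hf
  exact ⟨M, hM, fun x => ⟨(h x).1.comp_injective hj,
    (tsum_comp_le_tsum_of_inj (h x).1 (fun _ => by positivity) hj).trans (h x).2⟩⟩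

theorem summable_norm_inner_sq {f : ι → H} (hf : Summable fun i => ‖f i‖ ^ 2) (x : H) :
    Summable (fun i => ‖inner 𝕜 x (f i)‖ ^ 2) ∧
      ∑' i, ‖inner 𝕜 x (f i)‖ ^ 2 ≤ (∑' i, ‖f i‖ ^ 2) * ‖x‖ ^ 2 := by
  have hle : ∀ i, ‖inner 𝕜 x (f i)‖ ^ 2 ≤ ‖f i‖ ^ 2 * ‖x‖ ^ 2 := fun i => by
    rw [← mul_pow, mul_comm]
    exact pow_le_pow_left₀ (norm_nonneg _) (norm_inner_le_norm _ _) 2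
  have hs := Summable.of_nonneg_of_le (fun i => by positivity) hle (hf.mul_right _)
  exact ⟨hs, (hs.tsum_le_tsum hle (hf.mul_right _)).trans_eq tsum_mul_right⟩

theorem norm_inner_sq_le (x u v : H) :
    ‖inner 𝕜 x u‖ ^ 2 ≤ 2 * ‖inner 𝕜 x v‖ ^ 2 + 2 * ‖inner 𝕜 x (u - v)‖ ^ 2 := by
  have : inner 𝕜 x u = inner 𝕜 x v + inner 𝕜 x (u - v) := by rw [← inner_add_right]; simp
  rw [this]
  exact norm_add_sq_le_two_mul _ _

theorem IsBessel.tsum_norm_inner_sq_le {f g : ι → H} (hf : IsBessel 𝕜 f)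
    (hfg : Summable fun i => ‖f i - g i‖ ^ 2) (x : H) :
    Summable (fun i => ‖inner 𝕜 x (g i)‖ ^ 2) ∧
      ∑' i, ‖inner 𝕜 x (g i)‖ ^ 2 ≤
        2 * ∑' i, ‖inner 𝕜 x (f i)‖ ^ 2 + 2 * ((∑' i, ‖f i - g i‖ ^ 2) * ‖x‖ ^ 2) := by
  obtain ⟨M, hM, h⟩ := hf
  obtain ⟨h1, h2⟩ := summable_norm_inner_sq (𝕜 := 𝕜) hfg x
  have hle : ∀ i, ‖inner 𝕜 x (g i)‖ ^ 2 ≤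
      2 * ‖inner 𝕜 x (f i)‖ ^ 2 + 2 * ‖inner 𝕜 x (f i - g i)‖ ^ 2 := fun i => by
    have := norm_inner_sq_le (𝕜 := 𝕜) x (g i) (f i)
    rwa [← neg_sub (f i) (g i), inner_neg_right, norm_neg] at this
  have hsum := ((h x).1.mul_left 2).add (h1.mul_left 2)
  have hs := Summable.of_nonneg_of_le (fun i => by positivity) hle hsum
  refine ⟨hs, (hs.tsum_le_tsum hle hsum).trans ?_⟩
  rw [((h x).1.mul_left 2).tsum_add (h1.mul_left 2), tsum_mul_left, tsum_mul_left]
  linarith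

theorem IsBessel.of_summable_sub {f g : ι → H} (hf : IsBessel 𝕜 f)
    (hfg : Summable fun i => ‖f i - g i‖ ^ 2) : IsBessel 𝕜 g := by
  have key := hf.tsum_norm_inner_sq_le hfg
  obtain ⟨M, hM, h⟩ := hf
  have h0 : 0 ≤ ∑' i, ‖f i - g i‖ ^ 2 := tsum_nonneg fun _ => by positivity
  refine ⟨2 * M + 2 * ∑' i, ‖f i - g i‖ ^ 2, by positivity, fun x => ⟨(key x).1, ?_⟩⟩
  have := (h x).2
  linarith [(key x).2]

theorem IsBessel.sumElim {f : ι → H} (hf : IsBessel 𝕜 f) [Finite κ] (h : κ → H) :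
    IsBessel 𝕜 (Sum.elim h f) := by
  have := Fintype.ofFinite κ
  have hfin : Summable fun i => ‖h i‖ ^ 2 := Summable.of_finite
  have key := summable_norm_inner_sq (𝕜 := 𝕜) hfin
  obtain ⟨M, hM, hB⟩ := hf
  have h0 : 0 ≤ ∑' i, ‖h i‖ ^ 2 := tsum_nonneg fun _ => by positivity
  refine ⟨(∑' i, ‖h i‖ ^ 2) + M, by positivity, fun x => ?_⟩
  refine ⟨Summable.sum _ (key x).1 (hB x).1, ?_⟩
  rw [Summable.tsum_sum (f := fun i => ‖inner 𝕜 x (Sum.elim h f i)‖ ^ 2) (key x).1 (hB x).1,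
    add_mul]
  exact add_le_add (key x).2 (hB x).2

theorem IsFrame.of_comp_injective {f : ι → H} (hf : IsBessel 𝕜 f) {j : κ → ι}
    (hj : Function.Injective j) (h : IsFrame 𝕜 (f ∘ j)) : IsFrame 𝕜 f := by
  obtain ⟨m, hm, hl⟩ := h.lower
  refine ⟨hf, m, hm, fun x => (hl x).trans ?_⟩
  obtain ⟨M, hM, hB⟩ := hf
  exact tsum_comp_le_tsum_of_inj (hB x).1 (fun _ => by positivity) hj

theorem IsFrame.comp_equiv {f : ι → H} (hf : IsFrame 𝕜 f) (e : κ ≃ ι) : IsFrame 𝕜 (f ∘ e) := by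
  refine .of_comp_injective (hf.bessel.comp_injective e.injective) e.symm.injective ?_
  simpa [Function.comp_assoc] using hf

/-- The lower frame bound survives an `ℓ²`-small perturbation. -/
theorem IsFrame.exists_perturbation_bound {f : ι → H} (hf : IsFrame 𝕜 f) :
    ∃ δ : ℝ, 0 < δ ∧ ∀ g : ι → H, (Summable fun i => ‖f i - g i‖ ^ 2) →
      ∑' i, ‖f i - g i‖ ^ 2 ≤ δ → IsFrame 𝕜 g := by
  obtain ⟨m, hm, hl⟩ := hf.lower
  -- From `m ‖x‖² ≤ 2 ∑ |⟨x, g i⟩|² + 2 (m / 4) ‖x‖²` the bound `m / 4` remains for `g`.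
  refine ⟨m / 4, by positivity, fun g hs hδ => ?_⟩
  have hg := hf.bessel.of_summable_sub hs
  refine ⟨hg, m / 4, by positivity, fun x => ?_⟩
  have hs' : Summable fun i => ‖g i - f i‖ ^ 2 := by simpa only [norm_sub_rev] using hs
  have h1 := (hg.tsum_norm_inner_sq_le hs' x).2
  simp only [norm_sub_rev (g _)] at h1
  have h2 := mul_le_mul_of_nonneg_right hδ (sq_nonneg ‖x‖)
  linarith [hl x]

/-- The terms in the difference of two finite sets can be moved to the finite part of an index
type. -/
theorem exists_equiv_fin_sum_compl {σ τ : Finset ℕ} (hst : σ ⊆ τ) (m : ℕ) :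
    ∃ (k : ℕ) (e : Fin k ⊕ {n : ℕ // n ∉ τ} ≃ Fin m ⊕ {n : ℕ // n ∉ σ}),
      ∀ n : {n : ℕ // n ∉ τ}, e (Sum.inr n) = Sum.inr ⟨n, fun h => n.2 (hst h)⟩ := by
  let j : (Fin m ⊕ {n : ℕ // n ∈ τ \ σ}) ⊕ {n : ℕ // n ∉ τ} → Fin m ⊕ {n : ℕ // n ∉ σ} :=
    Sum.elim (Sum.map id fun n => ⟨n, (Finset.mem_sdiff.1 n.2).2⟩)
      fun n => Sum.inr ⟨n, fun h => n.2 (hst h)⟩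
  have hj : Function.Bijective j := by
    constructor
    · rintro ((a | ⟨a, ha⟩) | ⟨a, ha⟩) ((b | ⟨b, hb⟩) | ⟨b, hb⟩) hab <;>
        simp [j] at hab ⊢ <;> grind
    · rintro (a | ⟨a, ha⟩)
      · exact ⟨.inl (.inl a), rfl⟩
      · by_cases hτ : a ∈ τ
        · exact ⟨.inl (.inr ⟨a, Finset.mem_sdiff.2 ⟨hτ, ha⟩⟩), rfl⟩
        · exact ⟨.inr ⟨a, hτ⟩, rfl⟩
  exact ⟨_, (Equiv.sumCongr (Fintype.equivFin _).symm (Equiv.refl _)).trans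
    (Equiv.ofBijective j hj), fun n => rfl⟩

theorem exists_finset_tsum_compl_le (a : ℕ → ℝ) (σ : Finset ℕ)
    {δ : ℝ} (hδ : 0 < δ) :
    ∃ τ : Finset ℕ, σ ⊆ τ ∧ ∑' n : {n : ℕ // n ∉ τ}, a n ≤ δ := by
  have h := tendsto_tsum_compl_atTop_zero a
  obtain ⟨τ, h1, h2⟩ := ((h.eventually_le_const hδ).and (Filter.eventually_ge_atTop σ)).exists
  exact ⟨τ, h2, h1⟩

/-- Finitely many vectors together with a tail of `f` can be approximated in `ℓ²`, after a
reindexing, by finitely many vectors together with a tail of `g`. -/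
theorem exists_tail_replacement {f g : ℕ → H} (hfg : Summable fun n => ‖f n - g n‖ ^ 2)
    (σ : Finset ℕ) {m : ℕ} (h : Fin m → H) {δ : ℝ} (hδ : 0 < δ) :
    ∃ (τ : Finset ℕ) (k : ℕ) (e : Fin k ⊕ {n : ℕ // n ∉ τ} ≃ Fin m ⊕ {n : ℕ // n ∉ σ})
      (h' : Fin k → H),
      (Summable fun i => ‖Sum.elim h (fun n : {n : ℕ // n ∉ σ} => f n) i -
        (Sum.elim h' (fun n : {n : ℕ // n ∉ τ} => g n) ∘ e.symm) i‖ ^ 2) ∧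
      ∑' i, ‖Sum.elim h (fun n : {n : ℕ // n ∉ σ} => f n) i -
        (Sum.elim h' (fun n : {n : ℕ // n ∉ τ} => g n) ∘ e.symm) i‖ ^ 2 ≤ δ := by
  obtain ⟨τ, hστ, hτ⟩ := exists_finset_tsum_compl_le (fun n => ‖f n - g n‖ ^ 2) σ hδ
  obtain ⟨k, e, he⟩ := exists_equiv_fin_sum_compl hστ m
  set u := Sum.elim h (fun n : {n : ℕ // n ∉ σ} => f n)
  -- The finite part of the new family is copied from `u`, so only the tail over the complement of
  -- `τ` contributes to the error.
  have hsum : HasSum (fun i => ‖u (e i) -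
      Sum.elim (fun i => u (e (Sum.inl i))) (fun n : {n : ℕ // n ∉ τ} => g n) i‖ ^ 2)
      (0 + ∑' n : {n : ℕ // n ∉ τ}, ‖f n - g n‖ ^ 2) := by
    refine HasSum.sum ?_ ?_
    · convert hasSum_zero (α := ℝ) (β := Fin k) using 2 with i
      simp
    · have hcomp : (fun i => ‖u (e i) - Sum.elim (fun i => u (e (Sum.inl i)))
          (fun n : {n : ℕ // n ∉ τ} => g n) i‖ ^ 2) ∘ Sum.inr =
            fun n : {n : ℕ // n ∉ τ} => ‖f n - g n‖ ^ 2 := by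
        ext n
        simp only [Function.comp_apply, he, Sum.elim_inr, u]
      rw [hcomp]
      exact (hfg.subtype {n | n ∉ τ}).hasSum
  have hsum' : HasSum (fun i => ‖u i - (Sum.elim (fun i => u (e (Sum.inl i)))
      (fun n : {n : ℕ // n ∉ τ} => g n) ∘ e.symm) i‖ ^ 2)
      (0 + ∑' n : {n : ℕ // n ∉ τ}, ‖f n - g n‖ ^ 2) := by
    rw [← e.hasSum_iff]
    simpa [Function.comp_def] using hsum
  exact ⟨τ, k, e, _, hsum'.summable, by rwa [hsum'.tsum_eq, zero_add]⟩

theorem IsPseudoFrame.of_summable_sub {f g : ℕ → H} (hf : IsPseudoFrame 𝕜 f)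
    (hfg : Summable fun n => ‖f n - g n‖ ^ 2) : IsPseudoFrame 𝕜 g := by
  obtain ⟨m, h, hF⟩ := hf.exists_frame
  have hF' : IsFrame 𝕜 (Sum.elim h (fun n : {n : ℕ // n ∉ (∅ : Finset ℕ)} => f n)) := by
    convert hF.comp_equiv ((Equiv.refl (Fin m)).sumCongr
      (Equiv.subtypeUnivEquiv fun n => Finset.notMem_empty n)) using 1
    ext (i | n) <;> rfl
  obtain ⟨δ, hδ, hpert⟩ := hF'.exists_perturbation_bound
  obtain ⟨τ, k, e, h', h1, h2⟩ := exists_tail_replacement hfg ∅ h hδ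
  have hg := hf.bessel.of_summable_sub hfg
  have hG := (hpert _ h1 h2).comp_equiv e
  -- The terms of `g` indexed by `τ` are put back: enlarging a family within a Bessel family keeps
  -- the lower frame bound.
  refine ⟨hg, k, h', .of_comp_injective (hg.sumElim h')
    (Function.injective_id.sumMap Subtype.val_injective) (j := Sum.map id
      (Subtype.val : {n : ℕ // n ∉ τ} → ℕ)) ?_⟩
  rw [Function.comp_assoc, e.symm_comp_self, Function.comp_id] at hG
  rwa [Sum.elim_comp_map]

/-! ### Riesz sequences, closed range of synthesis operators, and stability. -/

section Complete

variable [CompleteSpace H]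

/-- Truncated coefficients give one direction, passage to the limit the other. Finite sums make
reindexing and perturbation free of convergence questions. -/
theorem isRieszSequence_iff_finset {f : ι → H} :
    IsRieszSequence 𝕜 f ↔ IsBessel 𝕜 f ∧ ∃ m : ℝ, 0 < m ∧ ∀ (c : ι → 𝕜) (s : Finset ι),
      m * ∑ i ∈ s, ‖c i‖ ^ 2 ≤ ‖∑ i ∈ s, c i • f i‖ ^ 2 := by
  classical
  constructor
  · rintro ⟨hB, m, hm, h⟩
    refine ⟨hB, m, hm, fun c s => ?_⟩
    have hmem : Memℓp (fun i => if i ∈ s then c i else 0) 2 := by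
      refine memℓp_gen (summable_of_ne_finset_zero (s := s) fun i hi => ?_)
      simp [hi]
    have := h ⟨_, hmem⟩
    rw [tsum_eq_sum (s := s) (fun i hi => by simp [hi]),
      tsum_eq_sum (s := s) (fun i hi => by simp [hi])] at this
    have e1 : ∑ i ∈ s, ‖if i ∈ s then c i else 0‖ ^ 2 = ∑ i ∈ s, ‖c i‖ ^ 2 :=
      Finset.sum_congr rfl fun i hi => by rw [if_pos hi]
    have e2 : ∑ i ∈ s, (if i ∈ s then c i else 0) • f i = ∑ i ∈ s, c i • f i :=
      Finset.sum_congr rfl fun i hi => by rw [if_pos hi]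
    rwa [e1, e2] at this
  · rintro ⟨hB, m, hm, h⟩
    refine ⟨hB, m, hm, fun c => ?_⟩
    have h1 := ((EllTwo.hasSum_sq c).summable.hasSum.mul_left m)
    have h2 := (hB.summable_smul c).hasSum.norm.pow 2
    refine le_of_tendsto_of_tendsto' h1 h2 fun s => ?_
    rw [← Finset.mul_sum]
    exact h c s

theorem IsRieszSequence.comp_injective {f : ι → H} (hf : IsRieszSequence 𝕜 f) {j : κ → ι}
    (hj : Function.Injective j) : IsRieszSequence 𝕜 (f ∘ j) := by
  obtain ⟨hB, m, hm, h⟩ := isRieszSequence_iff_finset.1 hf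
  refine isRieszSequence_iff_finset.2 ⟨hB.comp_injective hj, m, hm, fun c s => ?_⟩
  have := h (Function.extend j c 0) (s.map ⟨j, hj⟩)
  simpa [hj.extend_apply] using this

/-- The lower Riesz bound survives an `ℓ²`-small perturbation. -/
theorem IsRieszSequence.exists_perturbation_bound {f : ι → H} (hf : IsRieszSequence 𝕜 f) :
    ∃ δ : ℝ, 0 < δ ∧ ∀ g : ι → H, (Summable fun i => ‖f i - g i‖ ^ 2) →
      ∑' i, ‖f i - g i‖ ^ 2 ≤ δ → IsRieszSequence 𝕜 g := by
  obtain ⟨hB, m, hm, h⟩ := isRieszSequence_iff_finset.1 hf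
  refine ⟨m / 4, by positivity, fun g hs hδ => ?_⟩
  refine isRieszSequence_iff_finset.2
    ⟨hB.of_summable_sub hs, m / 4, by positivity, fun c s => ?_⟩
  have hsplit : ∑ i ∈ s, c i • f i = ∑ i ∈ s, c i • g i + ∑ i ∈ s, c i • (f i - g i) := by
    rw [← Finset.sum_add_distrib]
    simp [smul_sub]
  have h1 := norm_add_sq_le_two_mul (∑ i ∈ s, c i • g i) (∑ i ∈ s, c i • (f i - g i))
  rw [← hsplit] at h1
  have hC : 0 ≤ ∑ i ∈ s, ‖c i‖ ^ 2 := Finset.sum_nonneg fun i _ => by positivity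
  have h2 : ‖∑ i ∈ s, c i • (f i - g i)‖ ^ 2 ≤ (∑ i ∈ s, ‖c i‖ ^ 2) * (m / 4) := by
    have h3 : ‖∑ i ∈ s, c i • (f i - g i)‖ ≤ ∑ i ∈ s, ‖c i‖ * ‖f i - g i‖ :=
      (norm_sum_le _ _).trans_eq (by simp only [norm_smul])
    refine (pow_le_pow_left₀ (norm_nonneg _) h3 2).trans
      ((Finset.sum_mul_sq_le_sq_mul_sq s _ _).trans (mul_le_mul_of_nonneg_left ?_ hC))
    exact (hs.sum_le_tsum s fun _ _ => by positivity).trans hδ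
  linarith [h c s]

theorem IsBessel.adjoint_synthesis_apply {f : ι → H} (hf : IsBessel 𝕜 f) (x : H) (i : ι) :
    hf.synthesis.adjoint x i = inner 𝕜 (f i) x := by
  classical
  have h := ContinuousLinearMap.adjoint_inner_right hf.synthesis
    (lp.single 2 i (1 : 𝕜) : EllTwo 𝕜 ι) x
  rw [lp.inner_single_left, hf.synthesis_apply, tsum_eq_single i (fun j hj => by
    simp [Pi.single_eq_of_ne hj])] at h
  simpa [lp.coeFn_single] using h

/-- Turns a lower frame bound into a lower bound for the adjoint. -/
theorem IsBessel.norm_adjoint_synthesis_sq {f : ι → H} (hf : IsBessel 𝕜 f) (x : H) :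
    ‖hf.synthesis.adjoint x‖ ^ 2 = ∑' i, ‖inner 𝕜 x (f i)‖ ^ 2 := by
  rw [← (EllTwo.hasSum_sq _).tsum_eq]
  simp only [hf.adjoint_synthesis_apply, norm_inner_symm x]

theorem IsPseudoRieszSequence.reducedMinimumModulus_pos {f : ℕ → H}
    (hf : IsPseudoRieszSequence 𝕜 f) : 0 < reducedMinimumModulus hf.bessel.synthesis := by
  obtain ⟨σ, hσ⟩ := hf.exists_rieszSequence
  obtain ⟨m, hm, h⟩ := hσ.lower
  refine _root_.reducedMinimumModulus_pos _
    (ContinuousLinearMap.exists_preimage_of_isClosed_range _ ?_)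
  -- The finite-rank map reads the coordinates in `σ`; on its kernel only the Riesz sequence is
  -- being synthesised.
  refine ContinuousLinearMap.isClosed_range_of_boundedBelow_on_ker _
    (ContinuousLinearMap.pi fun i : σ => lp.evalCLM 𝕜 (fun _ : ℕ => 𝕜) 2 i.1) hm fun c hc => ?_
  have hc0 : ∀ i ∈ σ, c i = 0 := fun i hi => congrFun hc ⟨i, hi⟩
  have hsq : HasSum (fun n : {n : ℕ // n ∉ σ} => ‖c n‖ ^ 2) (‖c‖ ^ 2) := by
    refine (hasSum_subtype_iff_of_support_subset (s := {n | n ∉ σ}) ?_).2 (EllTwo.hasSum_sq c)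
    intro i hi hiσ
    exact hi (by simp [hc0 i hiσ])
  have hmem : Memℓp (fun n : {n : ℕ // n ∉ σ} => c n) 2 := memℓp_gen (by simpa using hsq.summable)
  have := h ⟨_, hmem⟩
  simp only at this
  rw [hsq.tsum_eq] at this
  have hsub : ∑' n : {n : ℕ // n ∉ σ}, c n • f n = ∑' n, c n • f n := by
    refine tsum_subtype_eq_of_support_subset (s := {n | n ∉ σ}) (f := fun n => c n • f n) ?_
    intro i hi hiσ
    exact hi (by simp [hc0 i hiσ])
  rw [hf.bessel.synthesis_apply, ← hsub]
  exact this

theorem IsPseudoFrame.reducedMinimumModulus_pos {f : ℕ → H}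
    (hf : IsPseudoFrame 𝕜 f) : 0 < reducedMinimumModulus hf.bessel.synthesis := by
  obtain ⟨k, h, hh⟩ := hf.exists_frame
  obtain ⟨m, hm, hl⟩ := hh.lower
  refine _root_.reducedMinimumModulus_pos _
    (ContinuousLinearMap.exists_preimage_of_isClosed_range_adjoint _ ?_)
  -- On the orthogonal complement of the added vectors `h i`, the frame sum reduces to that of `f`.
  refine ContinuousLinearMap.isClosed_range_of_boundedBelow_on_ker _
    (ContinuousLinearMap.pi fun i : Fin k => innerSL 𝕜 (h i)) hm fun x hx => ?_
  have hx0 : ∀ i, inner 𝕜 x (h i) = 0 := fun i => inner_eq_zero_symm.1 (congrFun hx i)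
  obtain ⟨M, -, hB⟩ := hf.bessel
  have := hl x
  rw [Summable.tsum_sum (f := fun i => ‖inner 𝕜 x (Sum.elim h f i)‖ ^ 2) Summable.of_finite
    (hB x).1] at this
  rw [hf.bessel.norm_adjoint_synthesis_sq]
  simpa [hx0] using this

theorem IsPseudoRieszBasis.isPseudoRieszSequence {f : ℕ → H} (hf : IsPseudoRieszBasis 𝕜 f) :
    IsPseudoRieszSequence 𝕜 f := by
  obtain ⟨σ, m, h, hR⟩ := hf.exists_rieszBasis
  exact ⟨hf.bessel, σ, hR.rieszSequence.comp_injective Sum.inr_injective⟩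

theorem IsPseudoRieszSequence.of_summable_sub {f g : ℕ → H} (hf : IsPseudoRieszSequence 𝕜 f)
    (hfg : Summable fun n => ‖f n - g n‖ ^ 2) : IsPseudoRieszSequence 𝕜 g := by
  obtain ⟨σ, hσ⟩ := hf.exists_rieszSequence
  have hR : IsRieszSequence 𝕜 (Sum.elim (Fin.elim0 : Fin 0 → H)
      (fun n : {n : ℕ // n ∉ σ} => f n)) := by
    convert hσ.comp_injective (Equiv.emptySum (Fin 0) _).injective using 1
    ext (i | n)
    · exact i.elim0
    · rfl
  obtain ⟨δ, hδ, hpert⟩ := hR.exists_perturbation_bound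
  obtain ⟨τ, k, e, h', h1, h2⟩ := exists_tail_replacement hfg σ (Fin.elim0 : Fin 0 → H) hδ
  -- Restriction along `e ∘ Sum.inr` discards the vectors `h'`, leaving the tail of `g`.
  exact ⟨hf.bessel.of_summable_sub hfg, τ,
    (hpert _ h1 h2).comp_injective (j := e ∘ Sum.inr) (e.injective.comp Sum.inr_injective)
      |> fun h => by simpa [Function.comp_def] using h⟩

theorem IsPseudoRieszBasis.of_summable_sub {f g : ℕ → H} (hf : IsPseudoRieszBasis 𝕜 f)
    (hfg : Summable fun n => ‖f n - g n‖ ^ 2) : IsPseudoRieszBasis 𝕜 g := by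
  obtain ⟨σ, m, h, hF, hR⟩ := hf.exists_rieszBasis
  obtain ⟨δ₁, hδ₁, hpert₁⟩ := hF.exists_perturbation_bound
  obtain ⟨δ₂, hδ₂, hpert₂⟩ := hR.exists_perturbation_bound
  -- One replacement must serve both bounds, so that the same family is a frame and a Riesz
  -- sequence.
  obtain ⟨τ, k, e, h', h1, h2⟩ := exists_tail_replacement hfg σ h (lt_min hδ₁ hδ₂)
  have hG := (hpert₁ _ h1 (h2.trans (min_le_left _ _))).comp_equiv e
  have hS := (hpert₂ _ h1 (h2.trans (min_le_right _ _))).comp_injective e.injective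
  rw [Function.comp_assoc, e.symm_comp_self, Function.comp_id] at hG hS
  exact ⟨hf.bessel.of_summable_sub hfg, τ, k, h', hG, hS⟩

end Complete

end Families

theorem summable_norm_sq_of_tsum_enorm_sq_lt {H : Type*} [SeminormedAddCommGroup H] {u : ℕ → H}
    {a : ℝ≥0∞} (h : ∑' n, ‖u n‖ₑ ^ 2 < a) : Summable fun n => ‖u n‖ ^ 2 := by
  simpa using ENNReal.summable_toReal h.ne_top

theorem mainTheorem5 {𝕜 : Type*} [RCLike 𝕜]
    {H : Type*} [NormedAddCommGroup H] [InnerProductSpace 𝕜 H] [CompleteSpace H]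
    (f : ℕ → H) :
    (∀ hf : IsPseudoRieszSequence 𝕜 f,
      0 < reducedMinimumModulus hf.bessel.synthesis ∧
      ∀ g : ℕ → H,
        ∑' n, ‖f n - g n‖ₑ ^ 2 < reducedMinimumModulus hf.bessel.synthesis ^ 2 →
        IsPseudoRieszSequence 𝕜 g) ∧
    (∀ hf : IsPseudoFrame 𝕜 f,
      0 < reducedMinimumModulus hf.bessel.synthesis ∧
      ∀ g : ℕ → H,
        ∑' n, ‖f n - g n‖ₑ ^ 2 < reducedMinimumModulus hf.bessel.synthesis ^ 2 →
        IsPseudoFrame 𝕜 g) ∧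
    (∀ hf : IsPseudoRieszBasis 𝕜 f,
      0 < reducedMinimumModulus hf.bessel.synthesis ∧
      ∀ g : ℕ → H,
        ∑' n, ‖f n - g n‖ₑ ^ 2 < reducedMinimumModulus hf.bessel.synthesis ^ 2 →
        IsPseudoRieszBasis 𝕜 g) := by
  exact ⟨fun hf => ⟨hf.reducedMinimumModulus_pos,
      fun _ hg => hf.of_summable_sub (summable_norm_sq_of_tsum_enorm_sq_lt hg)⟩,
    fun hf => ⟨hf.reducedMinimumModulus_pos,
      fun _ hg => hf.of_summable_sub (summable_norm_sq_of_tsum_enorm_sq_lt hg)⟩,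
    fun hf => ⟨hf.isPseudoRieszSequence.reducedMinimumModulus_pos,
      fun _ hg => hf.of_summable_sub (summable_norm_sq_of_tsum_enorm_sq_lt hg)⟩⟩
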